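/- Let $R$ be a commutative ring with identity and let $B(R)$ be the Boolean algebra (equivalently, Boolean ring) of its idempotents. For $x\in\operatorname{Spec} B(R)$ the Pierce stalk of $R$ at $x$ is the ring $R_x=R/xR$, where $xR$ is the ideal of $R$ generated by the idempotents belonging to $x$. Suppose that every Pierce stalk $R_x$ is projective free, that is, every finitely generated projective $R_x$-module is free. Let $h\in R[t]$ be a monic polynomial of degree $n$, and for $A\in M_n(R)$ let $\chi(A)$ denote its characteristic polynomial. Then the following are equivalent. (1) Every $A\in M_n(R)$ with $\chi(A)=h$ is strongly $\pi$-regular. (2) There exists $A\in M_n(R)$ with $\chi(A)=h$ which is strongly $\pi$-regular. (3) The polynomial $h$ has a gSP-factorization. Here an element $a$ of a ring $S$ is strongly $\pi$-regular if both chains of one-sided ideals $aS\supseteq a^2S\supseteq a^3S\supseteq\cdots$ and $Sa\supseteq Sa^2\supseteq Sa^3\supseteq\cdots$ terminate. For a commutative ring $S$, an SP-factorization of a polynomial $g\in S[t]$ is a factorization $g=h_0p_0$ in $S[t]$ such that $h_0(0)$ is a unit of $S$ and all coefficients of $p_0-t^{\deg p_0}$ are nilpotent. The polynomial $h\in R[t]$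 has a gSP-factorization if there are orthogonal idempotents $e_1,\dots,e_k\in R$ with $e_1+\cdots+e_k=1$ such that, for each $i$, the polynomial $e_ih$ has an SP-factorization in $(e_iR)[t]$, where $e_iR$ is regarded as a ring with identity $e_i$. -/

import Mathlib

open Polynomial

universe u

/-- The Boolean algebra `B(R)` of idempotents of a commutative ring, viewed as a Boolean ring
(addition is the symmetric difference `e + f - 2ef`, multiplication is that of `R`). -/
abbrev IdempotentBoolRing (R : Type u) [CommRing R] : Type u :=
  AsBoolRing {e : R // IsIdempotentElem e}

/-- The ideal `xR` of `R` generated by the idempotents lying in a prime ideal `x` of `B(R)`. -/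
def pierceIdeal {R : Type u} [CommRing R] (x : PrimeSpectrum (IdempotentBoolRing R)) : Ideal R :=
  Ideal.span {r : R | ∃ e ∈ x.asIdeal, r = (ofBoolRing e : {e : R // IsIdempotentElem e})}

/-- The Pierce stalk `R_x = R / xR` at a point `x` of `Spec B(R)`. -/
abbrev PierceStalk {R : Type u} [CommRing R] (x : PrimeSpectrum (IdempotentBoolRing R)) : Type u :=
  R ⧸ pierceIdeal x

/-- A commutative ring is projective free if every finitely generated projective module is free.
(A finitely generated module is isomorphic to one in the universe of the ring.) -/
def IsProjectiveFree (S : Type u) [CommRing S] : Prop :=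
  ∀ (P : Type u) [AddCommGroup P] [Module S P],
    Module.Finite S P → Module.Projective S P → Module.Free S P

/-- An element `a` of a (not necessarily commutative) ring is strongly π-regular if both chains
`aS ⊇ a²S ⊇ a³S ⊇ ⋯` and `Sa ⊇ Sa² ⊇ Sa³ ⊇ ⋯` of one-sided ideals terminate. -/
def IsStronglyPiRegular {S : Type u} [Ring S] (a : S) : Prop :=
  (∃ k : ℕ, ∀ m : ℕ, k ≤ m →
      Set.range (fun s : S => a ^ m * s) = Set.range (fun s : S => a ^ k * s)) ∧
  (∃ k : ℕ, ∀ m : ℕ, k ≤ m →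
      Set.range (fun s : S => s * a ^ m) = Set.range (fun s : S => s * a ^ k))

/-- `h = h₀ * p₀` is an SP-factorization: `h₀(0)` is a unit and all coefficients of
`p₀ - t ^ deg p₀` lie in the nilradical. -/
structure IsSPFactorization {S : Type u} [CommRing S] (h h₀ p₀ : S[X]) : Prop where
  eq_mul : h = h₀ * p₀
  isUnit_eval_zero : IsUnit (h₀.eval 0)
  coeff_mem_nilradical : ∀ i : ℕ, (p₀ - X ^ p₀.natDegree).coeff i ∈ nilradical S

/-- The ring homomorphism `R → eR`, `r ↦ er` (written `ere`), where `e` is an idempotent and `eR`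
is the ring with identity element `e`. -/
def toCorner {R : Type u} [CommRing R] {e : R} (he : IsIdempotentElem e) : R →+* he.Corner where
  toFun r := ⟨e * r * e, r, rfl⟩
  map_one' := Subtype.ext (by change e * 1 * e = e; rw [mul_one, he.eq])
  map_zero' := Subtype.ext (by change e * 0 * e = 0; simp)
  map_add' a b := Subtype.ext (by change e * (a + b) * e = e * a * e + e * b * e; ring)
  map_mul' a b := Subtype.ext (by
    change e * (a * b) * e = e * a * e * (e * b * e)
    linear_combination (-(a * b * e ^ 2) - a * b * e) * he.eq)

/-- `h` has a gSP-factorization: for some complete orthogonal set of idempotents `e₁, …, eₖ`, each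
`h eᵢ` has an SP-factorization in `eᵢR[t]`. -/
def HasGSPFactorization {R : Type u} [CommRing R] (h : R[X]) : Prop :=
  ∃ (k : ℕ) (e : Fin k → R) (he : CompleteOrthogonalIdempotents e),
    ∀ i : Fin k, ∃ h₀ p₀ : (he.idem i).Corner[X],
      IsSPFactorization (h.map (toCorner (he.idem i))) h₀ p₀

/-! ### Strongly π-regular elements and Fitting idempotents -/

section StronglyPiRegular

variable {S : Type u} [Ring S]

/-! Both nontrivial implications avoid choosing bases. From (3) to (1), an SP-factorization makes
`h` divide some `X ^ k * (1 - X * g)`, so Cayley–Hamilton gives `A ^ k = A ^ (k + 1) * g(A)` on each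
corner, and these relations are glued along the idempotents. From (2) to (3), the Fitting idempotent
`E` of `A` splits the characteristic polynomial into a factor with unit constant term (`A`
invertible on the image of `E`) and one coming from a nilpotent matrix. The latter is a power of `t`
modulo nilpotents wherever `E` has constant rank; the coefficients of `det (t E + (1 - E))` cut `R`
into such pieces. A companion matrix gives (1) to (2). -/

theorem IsStronglyPiRegular.of_pow_eq {a c : S} (hc : Commute a c) {k : ℕ}
    (hk : a ^ k = a ^ (k + 1) * c) : IsStronglyPiRegular a := by
  have key : ∀ j : ℕ, a ^ k = a ^ (k + j) * c ^ j := by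
    intro j
    induction j with
    | zero => simp
    | succ j ih =>
      calc a ^ k = a ^ j * a ^ k * c ^ j := by rw [← pow_add, add_comm j k]; exact ih
        _ = a ^ j * (a ^ (k + 1) * c) * c ^ j := by rw [← hk]
        _ = a ^ (j + (k + 1)) * (c * c ^ j) := by rw [pow_add a j]; simp only [mul_assoc]
        _ = a ^ (k + (j + 1)) * c ^ (j + 1) := by
          rw [← pow_succ']; congr 2; omega
  refine ⟨⟨k, fun m hm => ?_⟩, ⟨k, fun m hm => ?_⟩⟩
  all_goals
    obtain ⟨j, rfl⟩ := Nat.exists_eq_add_of_le hm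
    apply Set.Subset.antisymm
    all_goals rintro _ ⟨s, rfl⟩
  · exact ⟨a ^ j * s, by simp only [pow_add, mul_assoc]⟩
  · exact ⟨c ^ j * s, by
      change a ^ (k + j) * (c ^ j * s) = a ^ k * s
      rw [← mul_assoc, ← key j]⟩
  · exact ⟨s * a ^ j, by
      change s * a ^ j * a ^ k = s * a ^ (k + j)
      rw [mul_assoc, ← pow_add, add_comm j k]⟩
  · exact ⟨s * c ^ j, by
      change s * c ^ j * a ^ (k + j) = s * a ^ k
      rw [mul_assoc, ← (hc.pow_pow (k + j) j).eq, ← key j]⟩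

/-- A strongly π-regular element `a` has a Fitting idempotent `e`: it commutes with `a`, and `a` is
nilpotent on the part of `1 - e` and invertible on that of `e`. -/
theorem IsStronglyPiRegular.exists_idempotent {a : S} (ha : IsStronglyPiRegular a) :
    ∃ e : S, IsIdempotentElem e ∧ Commute e a ∧ IsNilpotent ((1 - e) * a) ∧
      ∃ z, (1 - e - e * a) * z = 1 := by
  obtain ⟨⟨k₁, h₁⟩, ⟨k₂, h₂⟩⟩ := ha
  set l := max k₁ k₂ with hl
  -- The exponent `l + 1`, rather than `l`, lets a factor `a` be split off `b` even when `l = 0`; `a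
  -- ^ l * x` will then invert `a` on the part of `e = b * x = y * b`.
  set b := a ^ (l + 1) with hb
  obtain ⟨x, hx⟩ : ∃ x, b = b * b * x := by
    have h := (h₁ (l + 1 + (l + 1)) (by omega)).trans (h₁ (l + 1) (by omega)).symm
    obtain ⟨x, hx⟩ := h.symm.subset ⟨1, rfl⟩
    exact ⟨x, by simpa [pow_add a (l + 1), ← hb] using hx.symm⟩
  obtain ⟨y, hy⟩ : ∃ y, b = y * (b * b) := by
    have h := (h₂ (l + 1 + (l + 1)) (by omega)).trans (h₂ (l + 1) (by omega)).symm
    obtain ⟨y, hy⟩ := h.symm.subset ⟨1, rfl⟩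
    exact ⟨y, by simpa [pow_add a (l + 1), ← hb] using hy.symm⟩
  have hxy : b * x = y * b := by
    calc b * x = y * (b * b) * x := by rw [← hy]
      _ = y * (b * b * x) := by simp only [mul_assoc]
      _ = y * b := by rw [← hx]
  set e := b * x with he
  have hbe : b * e = b := by rw [he, ← mul_assoc, ← hx]
  have heb : e * b = b := by rw [hxy, mul_assoc, ← hy]
  have hee : e * e = e := by
    nth_rw 2 [he]
    rw [← mul_assoc, heb]
  have hba : b * a = a * b := by rw [hb, ← pow_succ, ← pow_succ']
  have hae : a * e = e * (a * e) := by
    calc a * e = b * (a * x) := by rw [he, ← mul_assoc, ← hba, mul_assoc]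
      _ = e * b * (a * x) := by rw [heb]
      _ = e * (b * a * x) := by simp only [mul_assoc]
      _ = e * (a * e) := by rw [hba, he, mul_assoc a b x]
  have hea : e * a = e * a * e := by
    calc e * a = y * b * a := by rw [hxy]
      _ = y * a * b := by rw [mul_assoc, hba, mul_assoc]
      _ = y * a * (b * e) := by rw [hbe]
      _ = y * (a * b) * e := by simp only [mul_assoc]
      _ = e * a * e := by rw [← hba, ← mul_assoc y b a, ← hxy]
  have hcomm : Commute e a := by
    change e * a = a * e
    rw [hea, hae, mul_assoc]
  -- `1 - e - e * a` acts as `1` on the part of `1 - e` and as `-a` on that of `e`, so it is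
  -- inverted piecewise.
  refine ⟨e, hee, hcomm, ⟨l + 1, ?_⟩, 1 - e - e * (a ^ l * x) * e, ?_⟩
  · rw [((Commute.one_left a).sub_left hcomm).mul_pow, ← hb, pow_succ, mul_assoc, sub_mul, one_mul,
      heb, sub_self, mul_zero]
  · have h1 : (1 - e) * (1 - e) = 1 - e := by
      rw [mul_sub, sub_mul, sub_mul, hee]; simp
    have h2 : (1 - e) * (e * (a ^ l * x) * e) = 0 := by
      simp only [← mul_assoc]; rw [sub_mul, hee]; simp
    have h3 : e * a * (1 - e) = 0 := by rw [mul_sub, ← hea, mul_one, sub_self]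
    have h4 : e * a * (e * (a ^ l * x) * e) = e := by
      calc e * a * (e * (a ^ l * x) * e) = e * a * e * (a ^ l * x) * e := by
            simp only [mul_assoc]
        _ = e * (a * a ^ l * x) * e := by rw [← hea]; simp only [mul_assoc]
        _ = e := by rw [← pow_succ', ← hb, ← he, hee, hee]
    rw [sub_mul _ (e * a), mul_sub (1 - e), mul_sub (e * a), h1, h2, h3, h4]
    simp

end StronglyPiRegular

/-! ### Matrices with a prescribed characteristic polynomial -/

/-- Take multiplication by the root on `R[t]/(h)`: by Cayley–Hamilton its characteristic polynomial
kills the root, hence is a multiple of `h` of the same degree. -/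
theorem Polynomial.Monic.exists_charpoly_eq {R : Type u} [CommRing R] {h : R[X]} (hh : h.Monic) :
    ∃ A : Matrix (Fin h.natDegree) (Fin h.natDegree) R, A.charpoly = h := by
  nontriviality R
  let B : Module.Basis (Fin h.natDegree) R (AdjoinRoot h) := AdjoinRoot.powerBasisAux' hh
  refine ⟨Algebra.leftMulMatrix B (AdjoinRoot.root h), ?_⟩
  refine (eq_of_monic_of_dvd_of_natDegree_le hh (Matrix.charpoly_monic _) ?_ ?_)
  · rw [← AdjoinRoot.mk_eq_zero, ← AdjoinRoot.aeval_eq]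
    apply Algebra.leftMulMatrix_injective B
    rw [← Polynomial.aeval_algHom_apply, Matrix.aeval_self_charpoly, map_zero]
  · simp

/-! ### From SP-factorizations to strong π-regularity -/

/-- `p₀` is a power of `X` plus a nilpotent, so it divides a power of `X`; `h₀`, rescaled to
constant term `1`, has the form `1 - X * g`. -/
theorem IsSPFactorization.exists_dvd {S : Type u} [CommRing S] {h h₀ p₀ : S[X]}
    (H : IsSPFactorization h h₀ p₀) : ∃ (k : ℕ) (g : S[X]), h ∣ X ^ k * (1 - X * g) := by
  have hnil : IsNilpotent (p₀ - X ^ p₀.natDegree) :=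
    Polynomial.isNilpotent_iff.2 fun i => mem_nilradical.1 (H.coeff_mem_nilradical i)
  obtain ⟨m, hm⟩ := hnil.neg
  obtain ⟨v, hv⟩ := H.isUnit_eval_zero.exists_right_inv
  have hp : p₀ ∣ X ^ (p₀.natDegree * m) := by
    have := sub_dvd_pow_sub_pow (X ^ p₀.natDegree : S[X]) (-(p₀ - X ^ p₀.natDegree)) m
    rw [hm, sub_zero, ← pow_mul] at this
    simpa using this
  have hX : X ∣ 1 - h₀ * C v := by
    rw [X_dvd_iff, coeff_zero_eq_eval_zero]
    simp [hv]
  obtain ⟨g, hg⟩ := hX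
  refine ⟨p₀.natDegree * m, g, ?_⟩
  rw [← hg, sub_sub_cancel, H.eq_mul, mul_comm h₀ p₀]
  exact mul_dvd_mul hp (dvd_mul_right _ _)

theorem toCorner_surjective {R : Type u} [CommRing R] {e : R} (he : IsIdempotentElem e) :
    Function.Surjective (toCorner he) := by
  rintro ⟨_, r, rfl⟩
  exact ⟨r, rfl⟩

theorem toCorner_eq_zero_iff {R : Type u} [CommRing R] {e : R} (he : IsIdempotentElem e) {r : R} :
    toCorner he r = 0 ↔ e * r = 0 := by
  have h : toCorner he r = 0 ↔ e * r * e = 0 := Subtype.ext_iff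
  rw [h, mul_right_comm, he.eq]

theorem toCorner_self {R : Type u} [CommRing R] {e : R} (he : IsIdempotentElem e) :
    toCorner he e = 1 :=
  Subtype.ext (by change e * e * e = e; rw [he.eq, he.eq])

theorem IsSPFactorization.exists_smul_pow_eq {R : Type u} [CommRing R] {m : Type*} [Fintype m]
    [DecidableEq m] {e : R} (he : IsIdempotentElem e) (A : Matrix m m R)
    {h₀ p₀ : he.Corner[X]} (H : IsSPFactorization (A.charpoly.map (toCorner he)) h₀ p₀) :
    ∃ (k : ℕ) (g : R[X]), e • A ^ k = e • (A ^ (k + 1) * aeval A g) := by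
  obtain ⟨k, g, hg⟩ := H.exists_dvd
  obtain ⟨g, rfl⟩ := Polynomial.map_surjective _ (toCorner_surjective he) g
  refine ⟨k, g, ?_⟩
  set f := toCorner he
  rw [← Matrix.charpoly_map] at hg
  have h0 : aeval (A.map f) (X ^ k * (1 - X * g.map f)) = 0 := by
    obtain ⟨w, hw⟩ := hg
    rw [hw, map_mul, Matrix.aeval_self_charpoly, zero_mul]
  have h1 : f.mapMatrix (aeval A (X ^ k * (1 - X * g))) = 0 := by
    rw [← h0, aeval_def, aeval_def, Polynomial.hom_eval₂]
    have : (X ^ k * (1 - X * g.map f) : he.Corner[X]) = (X ^ k * (1 - X * g)).map f := by simp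
    rw [this, eval₂_map]
    congr 1
    ext r i j
    simp [Matrix.algebraMap_matrix_apply, apply_ite f]
  have h2 : e • aeval A (X ^ k * (1 - X * g)) = 0 := by
    ext i j
    have := congrFun (congrFun h1 i) j
    exact (toCorner_eq_zero_iff he).1 this
  rw [← sub_eq_zero, ← smul_sub, ← h2]
  simp [mul_sub, pow_succ, mul_assoc]

theorem HasGSPFactorization.isStronglyPiRegular {R : Type u} [CommRing R] {n : ℕ}
    {A : Matrix (Fin n) (Fin n) R} (H : HasGSPFactorization A.charpoly) :
    IsStronglyPiRegular A := by
  obtain ⟨r, e, he, H⟩ := H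
  choose h₀ p₀ H using H
  choose k g hk using fun i => (H i).exists_smul_pow_eq (he.idem i) A
  set K := Finset.univ.sup k
  have key : ∀ i, e i • A ^ K = A ^ (K + 1) * (e i • aeval A (g i)) := by
    intro i
    obtain ⟨j, hj⟩ := Nat.exists_eq_add_of_le (Finset.le_sup (f := k) (Finset.mem_univ i))
    have hj' : K = j + k i := by rw [add_comm]; exact hj
    rw [hj', pow_add, ← mul_smul_comm, hk, mul_smul_comm, mul_smul_comm, ← mul_assoc, ← pow_add,
      add_assoc]
  refine IsStronglyPiRegular.of_pow_eq (c := ∑ i, e i • aeval A (g i)) (k := K) ?_ ?_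
  · refine Commute.sum_right _ _ _ fun i _ => Commute.smul_right ?_ _
    have := (Commute.all (X : R[X]) (g i)).map (aeval A)
    rwa [aeval_X] at this
  · rw [Finset.mul_sum, ← Finset.sum_congr rfl fun i _ => key i, ← Finset.sum_smul, he.complete,
      one_smul]

/-! ### The rank idempotents of an idempotent matrix -/

section RankPolynomial

variable {R : Type u} [CommRing R] {m : Type*} [Fintype m] [DecidableEq m]

/-- For an idempotent matrix `E`, the polynomial `det (t E + (1 - E))`, whose coefficients are the
idempotents cutting out the loci where the image of `E` has a given rank. -/
noncomputable def rankPolynomial (E : Matrix m m R) : R[X] :=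
  ((X : R[X]) • C.mapMatrix E + (1 - C.mapMatrix E)).det

theorem aeval_rankPolynomial (E : Matrix m m R) {S : Type*} [CommRing S] [Algebra R S] (s : S) :
    aeval s (rankPolynomial E) =
      (s • (algebraMap R S).mapMatrix E + (1 - (algebraMap R S).mapMatrix E)).det := by
  rw [rankPolynomial, AlgHom.map_det]
  congr 1
  ext i j
  simp [Matrix.one_apply, apply_ite (aeval s)]
  exact mul_comm _ _

theorem aeval_mul_rankPolynomial {E : Matrix m m R} (hE : IsIdempotentElem E)
    {S : Type*} [CommRing S] [Algebra R S] (s t : S) :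
    aeval (s * t) (rankPolynomial E) =
      aeval s (rankPolynomial E) * aeval t (rankPolynomial E) := by
  simp only [aeval_rankPolynomial]
  rw [← Matrix.det_mul]
  congr 1
  have h : (algebraMap R S).mapMatrix E * (algebraMap R S).mapMatrix E =
      (algebraMap R S).mapMatrix E := by rw [← map_mul, hE.eq]
  simp only [add_mul, mul_add, mul_sub, sub_mul, smul_mul_assoc, mul_smul_comm, h, one_mul, mul_one]
  module

/-- Writing `q` for the rank polynomial, compare coefficients of `t ^ j` in `q(st) = q(s) q(t)`,
with `s = C X` and `t = X` independent variables. -/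
theorem rankPolynomial_mul_C_coeff {E : Matrix m m R} (hE : IsIdempotentElem E) (j : ℕ) :
    rankPolynomial E * C ((rankPolynomial E).coeff j) = C ((rankPolynomial E).coeff j) * X ^ j := by
  have h := aeval_mul_rankPolynomial hE (C X : R[X][X]) X
  have h1 : aeval (C X : R[X][X]) (rankPolynomial E) = C (rankPolynomial E) := by
    have := Polynomial.aeval_algHom_apply (CAlgHom (R := R) (A := R[X])) X (rankPolynomial E)
    simpa using this
  have h2 : aeval (X : R[X][X]) (rankPolynomial E) = (rankPolynomial E).map C := by
    conv_rhs => rw [← eval₂_C_X (p := (rankPolynomial E).map C), eval₂_map]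
    rfl
  have h3 : aeval (C X * X : R[X][X]) (rankPolynomial E) =
      ((rankPolynomial E).map C).comp (C X * X) := by
    rw [aeval_def, comp, eval₂_map]
    rfl
  rw [h1, h2, h3] at h
  have := congrArg (fun p => p.coeff j) h
  simpa [comp_C_mul_X_coeff] using this.symm

theorem completeOrthogonalIdempotents_rankPolynomial_coeff {E : Matrix m m R}
    (hE : IsIdempotentElem E) :
    CompleteOrthogonalIdempotents
      fun j : Fin ((rankPolynomial E).natDegree + 1) => (rankPolynomial E).coeff j where
  idem j := by
    have := congrArg (fun p => p.coeff j) (rankPolynomial_mul_C_coeff hE (j : ℕ))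
    simpa [coeff_X_pow, IsIdempotentElem] using this
  ortho i j hij := by
    have := congrArg (fun p => p.coeff i) (rankPolynomial_mul_C_coeff hE (j : ℕ))
    simpa [coeff_X_pow, Fin.val_inj, hij] using this
  complete := by
    have h : (rankPolynomial E).eval 1 = 1 := by
      have := aeval_rankPolynomial E (1 : R)
      simpa using this
    rw [eval_eq_sum_range] at h
    rw [Fin.sum_univ_eq_sum_range (fun j => (rankPolynomial E).coeff j)]
    simpa using h

end RankPolynomial

/-! ### From strong π-regularity to gSP-factorizations

The image and kernel of the Fitting idempotent of a matrix are projective modules that need not be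
free. Their characteristic polynomials are defined globally by determinants, and the coefficients of
the rank polynomial cut out the loci where the ranks are constant. Hence the factorization exists
over every commutative ring, without any assumption on the Pierce stalks. -/

section Fitting

variable {R : Type u} [CommRing R] {m : Type*} [Fintype m] [DecidableEq m]

/-- The characteristic polynomial of `A` on the image of the idempotent `E`. -/
noncomputable def imageCharpoly (E A : Matrix m m R) : R[X] :=
  (C.mapMatrix E * A.charmatrix + (1 - C.mapMatrix E)).det

theorem commute_mapMatrix_charmatrix {E A : Matrix m m R} (hEA : Commute E A) :
    Commute (C.mapMatrix E) A.charmatrix := by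
  refine Commute.sub_right ?_ (hEA.map C.mapMatrix)
  exact (Matrix.scalar_commute X (fun r => Commute.all X r) _).symm

theorem charpoly_eq_imageCharpoly_mul {E A : Matrix m m R} (hE : IsIdempotentElem E)
    (hEA : Commute E A) :
    A.charpoly = imageCharpoly E A * imageCharpoly (1 - E) A := by
  rw [imageCharpoly, imageCharpoly, ← Matrix.det_mul, Matrix.charpoly]
  congr 1
  have h : C.mapMatrix E * C.mapMatrix E = C.mapMatrix E := by rw [← map_mul, hE.eq]
  have hc := (commute_mapMatrix_charmatrix hEA).eq
  rw [map_sub, map_one]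
  set F := C.mapMatrix E
  set T := A.charmatrix
  have h1 : F * T * F = F * T := by rw [mul_assoc, ← hc, ← mul_assoc, h]
  have h2 : F * (F * T) = F * T := by rw [← mul_assoc, h]
  simp only [sub_sub_cancel, add_mul, mul_add, sub_mul, mul_sub, one_mul, h]
  simp only [mul_assoc, h2]
  simp only [← mul_assoc, h1]
  abel

/-- `E * A` vanishes on the kernel of `E`, which therefore contributes `t` to the power of its rank;
the rank polynomial of `1 - E` expresses this when the rank varies. -/
theorem charpoly_mul_eq_imageCharpoly_mul_rankPolynomial {E A : Matrix m m R}
    (hE : IsIdempotentElem E) (hEA : Commute E A) :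
    (E * A).charpoly = imageCharpoly E A * rankPolynomial (1 - E) := by
  rw [imageCharpoly, rankPolynomial, ← Matrix.det_mul, Matrix.charpoly]
  congr 1
  have h : C.mapMatrix E * C.mapMatrix E = C.mapMatrix E := by rw [← map_mul, hE.eq]
  have hc : C.mapMatrix E * C.mapMatrix A = C.mapMatrix A * C.mapMatrix E :=
    (hEA.map C.mapMatrix).eq
  have hs : Matrix.scalar m (X : R[X]) = (X : R[X]) • (1 : Matrix m m R[X]) := by
    ext i j
    simp [Matrix.one_apply, Matrix.diagonal_apply]
  rw [Matrix.charmatrix, Matrix.charmatrix, hs, map_mul, map_sub, map_one]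
  set F := C.mapMatrix E
  set T := C.mapMatrix A
  have h1 : F * T * F = F * T := by rw [mul_assoc, ← hc, ← mul_assoc, h]
  simp only [sub_sub_cancel, add_mul, mul_add, sub_mul, mul_sub, one_mul, mul_one, h, mul_smul_comm,
    smul_mul_assoc, h1]
  module

theorem isUnit_eval_zero_imageCharpoly {E A Z : Matrix m m R} (hZ : (1 - E - E * A) * Z = 1) :
    IsUnit ((imageCharpoly E A).eval 0) := by
  have h : (imageCharpoly E A).eval 0 = (1 - E - E * A).det := by
    rw [imageCharpoly, ← coe_evalRingHom, RingHom.map_det]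
    have h1 : (evalRingHom 0).mapMatrix (C.mapMatrix E) = E := by ext i j; simp
    have h2 : (evalRingHom 0).mapMatrix A.charmatrix = -A := by
      ext i j
      simp [Matrix.charmatrix_apply, Matrix.diagonal_apply, apply_ite (eval (0 : R))]
    rw [map_add, map_mul, map_sub, map_one, h1, h2]
    congr 1
    rw [mul_neg]
    abel
  rw [h]
  exact IsUnit.of_mul_eq_one Z.det (by rw [← Matrix.det_mul, hZ, Matrix.det_one])

/-- Modulo nilpotents the characteristic polynomial of `N` is a power of `X`, and the factor `X ^ j`
only shifts coefficients. -/
theorem coeff_sub_X_pow_mem_nilradical {S : Type u} [CommRing S] {N : Matrix m m S}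
    (hN : IsNilpotent N) {p : S[X]} {j : ℕ} (hp : N.charpoly = p * X ^ j) (i : ℕ) :
    (p - X ^ p.natDegree).coeff i ∈ nilradical S := by
  rw [mem_nilradical]
  nontriviality S
  have hmon : p.Monic := (monic_X_pow j).of_mul_monic_right (hp ▸ N.charpoly_monic)
  have hd : Fintype.card m = p.natDegree + j := by
    rw [← N.charpoly_natDegree_eq_dim, hp, hmon.natDegree_mul (monic_X_pow j), natDegree_X_pow]
  have := Polynomial.isNilpotent_iff.1 (Matrix.isNilpotent_charpoly_sub_pow_of_isNilpotent hN)
    (i + j)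
  rwa [hp, hd, pow_add, ← sub_mul, coeff_mul_X_pow] at this

end Fitting

theorem IsStronglyPiRegular.hasGSPFactorization {R : Type u} [CommRing R] {n : ℕ}
    {A : Matrix (Fin n) (Fin n) R} (hA : IsStronglyPiRegular A) :
    HasGSPFactorization A.charpoly := by
  obtain ⟨E, hE, hEA, hN, Z, hZ⟩ := hA.exists_idempotent
  have hc := completeOrthogonalIdempotents_rankPolynomial_coeff hE
  refine ⟨_, _, hc, fun j => ?_⟩
  have hf := toCorner_self (hc.idem j)
  set f := toCorner (hc.idem j)
  refine ⟨(imageCharpoly E A).map f, (imageCharpoly (1 - E) A).map f, ?_, ?_, ?_⟩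
  · rw [charpoly_eq_imageCharpoly_mul hE hEA, Polynomial.map_mul]
  · have := (isUnit_eval_zero_imageCharpoly hZ).map f
    rwa [← Polynomial.eval_map_apply, map_zero] at this
  -- The `j`-th coefficient becomes `1` in its own corner, where `E` has rank `j`.
  · have hq : (rankPolynomial E).map f = X ^ (j : ℕ) := by
      have := congrArg (Polynomial.map f) (rankPolynomial_mul_C_coeff hE (j : ℕ))
      simpa [hf] using this
    refine coeff_sub_X_pow_mem_nilradical (N := ((1 - E) * A).map f) (j := j)
      (hN.map f.mapMatrix) ?_
    rw [Matrix.charpoly_map, charpoly_mul_eq_imageCharpoly_mul_rankPolynomial hE.one_sub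
      ((Commute.one_left A).sub_left hEA), sub_sub_cancel, Polynomial.map_mul, hq]

theorem mainTheorem6 {R : Type u} [CommRing R]
    (hR : ∀ x : PrimeSpectrum (IdempotentBoolRing R), IsProjectiveFree (PierceStalk x))
    (n : ℕ) (h : R[X]) (hmonic : h.Monic) (hdeg : h.natDegree = n) :
    List.TFAE
      [∀ A : Matrix (Fin n) (Fin n) R, A.charpoly = h → IsStronglyPiRegular A,
       ∃ A : Matrix (Fin n) (Fin n) R, A.charpoly = h ∧ IsStronglyPiRegular A,
       HasGSPFactorization h] := by
  subst hdeg
  tfae_have 1 → 2 := fun H => hmonic.exists_charpoly_eq.imp fun A hA => ⟨hA, H A hA⟩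
  tfae_have 2 → 3 := by
    rintro ⟨A, hAh, hA⟩
    exact hAh ▸ hA.hasGSPFactorization
  tfae_have 3 → 1 := by
    rintro H A hA
    exact HasGSPFactorization.isStronglyPiRegular (hA.symm ▸ H)
  tfae_finish
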